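/- **Setting.** Let $I$ be a finite set of inputs and $O$ a set of outputs, disjoint from $I$. For a label set $L$, a *computation tree* is a function $l:(2^I)^*\to L$; a *tree path* is a sequence $\pi=n_1n_2\ldots$ of nodes with $n_{m+1}=n_m\cdot e_m$, $e_m\in 2^I$. *CTL\* with inputs* has state formulas $\Phi ::= \mathrm{true}\mid\mathrm{false}\mid o\mid\neg o\mid\Phi\wedge\Phi\mid\Phi\vee\Phi\mid \mathsf A\varphi\mid \mathsf E\varphi$ ($o\in O$) and path formulas $\varphi ::= \Phi\mid i\mid\neg i\mid\varphi\wedge\varphi\mid\varphi\vee\varphi\mid \mathsf X\varphi\mid\varphi\,\mathsf U\,\varphi\mid\varphi\,\mathsf R\,\varphi$ ($i\in I$). State formulas are evaluated at nodes of a tree $l:(2^I)^*\to 2^O$ ($n\models o$ iff $o\in l(n)$; $n\models\mathsf A\varphi$ resp. $\mathsf E\varphi$ iff all resp. some tree paths from $n$ satisfy $\varphi$) and path formulas on tree paths as usual, where $\pi\models i$ iff $i\in e_1$. A state formula is *realisable* if the root of some computation tree satisfies it. An LTL formula over inputs $I$ and finite-domain outputs (with atoms "output $=$ value") is *realisable*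 if there is a computation tree, labelled with assignments to the outputs, all of whose paths from the root satisfy it; position $m$ of a path carries the label of $n_m$ and the input $e_m$. **Reduction.** Let $\Phi$ be a CTL\* state formula, and let $F_{exist}$ and $F_{univ}$ be the finite sets of its subformulas of the form $\mathsf E\varphi$ and $\mathsf A\varphi$. For each $\mathsf E\varphi\in F_{exist}$ let $A_{\varphi}$ be any nondeterministic Büchi word automaton (finitely many states, one initial state) over the alphabet $2^{I\cup O\cup\{p_\theta\,:\,\theta\in F_{exist}\cup F_{univ}\}}$ that accepts exactly the words satisfying the LTL formula obtained from $\varphi$ by replacing each maximal quantified subformula $\theta$ by the proposition $p_{\theta}$. Let $k$ be the total number of states of the automata $A_\varphi$, $\mathsf E\varphi\in F_{exist}$. Introduce, besides the outputs $O$, fresh outputs: a Boolean $p_{\mathsf A\varphi}$ for each $\mathsf A\varphi\in F_{univ}$; a variable $v_{\mathsf E\varphi}\in\{0,\ldots,k\}$ for each $\mathsf E\varphi\in F_{exist}$; and for each $j\in\{1,\ldots,k\}$ Booleans $d_{j,i}$ ($i\in I$), which encode a direction in $2^I$. Write $d_j$ for the formula $\bigwedge_{i\in I}(i\leftrightarrow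 d_{j,i})$ ("the current input is the $j$-th direction"), and $\psi'$ for the result of replacing in $\psi$ each maximal quantified subformula $\mathsf E\varphi$ by $v_{\mathsf E\varphi}\neq0$ and $\mathsf A\varphi$ by $p_{\mathsf A\varphi}$. Let $$\Phi_{LTL}\;=\;\Phi'\;\wedge\bigwedge_{\mathsf E\varphi\in F_{exist}}\ \bigwedge_{j=1}^{k}\mathsf G\big[v_{\mathsf E\varphi}=j\to(\mathsf G\,d_j\to\varphi')\big]\;\wedge\bigwedge_{\mathsf A\varphi\in F_{univ}}\mathsf G\big[p_{\mathsf A\varphi}\to\varphi'\big].$$ **Theorem.** $\Phi$ is realisable if and only if $\Phi_{LTL}$ is realisable. -/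

import Mathlib

/-! Synthesis for CTL* with inputs and for LTL, and the reduction of the former to the latter. -/

namespace CTLStarSynthesis

universe u v w

/-! ### Computation trees -/

/-- Nodes of the exhaustive tree with directions `2^I`: finite words over `2^I`;
the root is `[]` and the child of `n` in direction `e` is `n ++ [e]`. -/
abbrev Node (I : Type u) : Type u := List (Set I)

/-- Exhaustive trees with directions `2^I` and node labels in `L`. -/
abbrev CompTree (I : Type u) (L : Type v) : Type (max u v) := Node I → L

/-- Tree paths, with positions numbered from `0`. -/
def IsTreePath {I : Type u} (π : ℕ → Node I) : Prop :=
  ∀ m, ∃ e : Set I, π (m + 1) = π m ++ [e]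

/-- The suffix of a sequence from position `m` on. -/
def suffix {α : Type u} (π : ℕ → α) (m : ℕ) : ℕ → α := fun j => π (m + j)

/-! ### CTL* with inputs -/

inductive Kind : Type
  | state
  | path

/-- CTL* formulas with inputs `I` and outputs `O` in positive normal form.
`CTLStar I O .state` are the state formulas, `CTLStar I O .path` the path formulas. -/
inductive CTLStar (I : Type u) (O : Type v) : Kind → Type (max u v)
  | tt : CTLStar I O .state
  | ff : CTLStar I O .state
  | out (o : O) : CTLStar I O .state
  | nout (o : O) : CTLStar I O .state
  | and {s : Kind} (φ ψ : CTLStar I O s) : CTLStar I O s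
  | or {s : Kind} (φ ψ : CTLStar I O s) : CTLStar I O s
  | all (φ : CTLStar I O .path) : CTLStar I O .state
  | ex (φ : CTLStar I O .path) : CTLStar I O .state
  | ofState (Φ : CTLStar I O .state) : CTLStar I O .path
  | inp (i : I) : CTLStar I O .path
  | ninp (i : I) : CTLStar I O .path
  | next (φ : CTLStar I O .path) : CTLStar I O .path
  | untl (φ ψ : CTLStar I O .path) : CTLStar I O .path
  | release (φ ψ : CTLStar I O .path) : CTLStar I O .path

/-- Where a formula is evaluated: a state formula at a node, a path formula on a sequence
of nodes. -/
abbrev Point (I : Type u) : Kind → Type u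
  | .state => Node I
  | .path => ℕ → Node I

namespace CTLStar

variable {I : Type u} {O : Type v}

/-- Satisfaction in a computation tree. Inputs are read off the direction that the path takes
out of its first node. -/
def Sat (l : CompTree I (Set O)) : {s : Kind} → CTLStar I O s → Point I s → Prop
  | _, .tt, _ => True
  | _, .ff, _ => False
  | _, .out o, n => o ∈ l n
  | _, .nout o, n => o ∉ l n
  | _, .and φ ψ, x => Sat l φ x ∧ Sat l ψ x
  | _, .or φ ψ, x => Sat l φ x ∨ Sat l ψ x
  | _, .all φ, n => ∀ π : ℕ → Node I, IsTreePath π → π 0 = n → Sat l φ π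
  | _, .ex φ, n => ∃ π : ℕ → Node I, IsTreePath π ∧ π 0 = n ∧ Sat l φ π
  | _, .ofState Φ, π => Sat l Φ (π 0)
  | _, .inp i, π => ∃ e : Set I, π 1 = π 0 ++ [e] ∧ i ∈ e
  | _, .ninp i, π => ∃ e : Set I, π 1 = π 0 ++ [e] ∧ i ∉ e
  | _, .next φ, π => Sat l φ (suffix π 1)
  | _, .untl φ ψ, π => ∃ m, Sat l ψ (suffix π m) ∧ ∀ j < m, Sat l φ (suffix π j)
  | _, .release φ ψ, π => (∀ m, Sat l ψ (suffix π m)) ∨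
      ∃ m, Sat l φ (suffix π m) ∧ ∀ j ≤ m, Sat l ψ (suffix π j)

/-- A state formula is realisable if the root of some computation tree satisfies it. -/
def Realisable (Φ : CTLStar I O .state) : Prop :=
  ∃ l : CompTree I (Set O), Sat l Φ []

open Classical in
/-- The finite set of those `φ` for which `E φ` is a subformula. -/
noncomputable def existSub : {s : Kind} → CTLStar I O s → Finset (CTLStar I O .path)
  | _, .tt => ∅
  | _, .ff => ∅
  | _, .out _ => ∅
  | _, .nout _ => ∅
  | _, .and φ ψ => existSub φ ∪ existSub ψ
  | _, .or φ ψ => existSub φ ∪ existSub ψ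
  | _, .all φ => existSub φ
  | _, .ex φ => insert φ (existSub φ)
  | _, .ofState Φ => existSub Φ
  | _, .inp _ => ∅
  | _, .ninp _ => ∅
  | _, .next φ => existSub φ
  | _, .untl φ ψ => existSub φ ∪ existSub ψ
  | _, .release φ ψ => existSub φ ∪ existSub ψ

open Classical in
/-- The finite set of those `φ` for which `A φ` is a subformula. -/
noncomputable def univSub : {s : Kind} → CTLStar I O s → Finset (CTLStar I O .path)
  | _, .tt => ∅
  | _, .ff => ∅
  | _, .out _ => ∅
  | _, .nout _ => ∅
  | _, .and φ ψ => univSub φ ∪ univSub ψ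
  | _, .or φ ψ => univSub φ ∪ univSub ψ
  | _, .all φ => insert φ (univSub φ)
  | _, .ex φ => univSub φ
  | _, .ofState Φ => univSub Φ
  | _, .inp _ => ∅
  | _, .ninp _ => ∅
  | _, .next φ => univSub φ
  | _, .untl φ ψ => univSub φ ∪ univSub ψ
  | _, .release φ ψ => univSub φ ∪ univSub ψ

/-- The quantified subformulas of a quantified subformula of `ψ` are among those of `ψ`. -/
theorem sub_of_mem_sub {s : Kind} (ψ : CTLStar I O s) :
    (∀ φ ∈ existSub ψ, existSub φ ⊆ existSub ψ ∧ univSub φ ⊆ univSub ψ) ∧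
    (∀ φ ∈ univSub ψ, existSub φ ⊆ existSub ψ ∧ univSub φ ⊆ univSub ψ) := by
  induction ψ <;>
    simp only [existSub, univSub, Finset.subset_iff, Finset.mem_union, Finset.mem_insert,
      Finset.notMem_empty] at * <;>
    grind

end CTLStar

/-! ### LTL -/

/-- LTL formulas over a set `P` of atomic propositions. -/
inductive LTL (P : Type u) : Type u
  | tt : LTL P
  | ff : LTL P
  | atom (p : P) : LTL P
  | neg (φ : LTL P) : LTL P
  | and (φ ψ : LTL P) : LTL P
  | next (φ : LTL P) : LTL P
  | untl (φ ψ : LTL P) : LTL P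

namespace LTL

variable {P : Type u}

/-- Satisfaction by an infinite word over the alphabet `2^P`. -/
def Sat : LTL P → (ℕ → Set P) → Prop
  | .tt, _ => True
  | .ff, _ => False
  | .atom p, σ => p ∈ σ 0
  | .neg φ, σ => ¬ Sat φ σ
  | .and φ ψ, σ => Sat φ σ ∧ Sat ψ σ
  | .next φ, σ => Sat φ (suffix σ 1)
  | .untl φ ψ, σ => ∃ m, Sat ψ (suffix σ m) ∧ ∀ j < m, Sat φ (suffix σ j)

def or (φ ψ : LTL P) : LTL P := neg (and (neg φ) (neg ψ))
def imp (φ ψ : LTL P) : LTL P := or (neg φ) ψ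
def iff (φ ψ : LTL P) : LTL P := and (imp φ ψ) (imp ψ φ)
def release (φ ψ : LTL P) : LTL P := neg (untl (neg φ) (neg ψ))
def eventually (φ : LTL P) : LTL P := untl tt φ
def always (φ : LTL P) : LTL P := neg (eventually (neg φ))

/-- The conjunction of a finite family of formulas (in an arbitrary order). -/
noncomputable def bigAnd {ι : Type w} [Fintype ι] (f : ι → LTL P) : LTL P :=
  (Finset.univ : Finset ι).toList.foldr (fun a φ => and (f a) φ) tt

end LTL

/-! ### LTL synthesis with Boolean inputs and finite-domain outputs -/

/-- Atomic propositions over Boolean inputs `I` and outputs `O`, where the output `o` takes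
values in `dom o`: an input, or an equation `o = c`. -/
inductive IOProp (I : Type u) (O : Type v) (dom : O → Type) : Type (max u v)
  | inp (i : I) : IOProp I O dom
  | outEq (o : O) (c : dom o) : IOProp I O dom

/-- The word of a tree path: at each position the label of the current node together with the
direction taken out of it. -/
def trace {I : Type u} {O : Type v} {dom : O → Type} (l : CompTree I (∀ o, dom o))
    (π : ℕ → Node I) : ℕ → Set (IOProp I O dom) :=
  fun m => {p | match p with
    | .inp i => ∃ e : Set I, π (m + 1) = π m ++ [e] ∧ i ∈ e
    | .outEq o c => l (π m) o = c}

/-- An LTL formula is realisable if there is a computation tree all of whose paths from the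
root satisfy it. -/
def LTL.Realisable {I : Type u} {O : Type v} {dom : O → Type} (φ : LTL (IOProp I O dom)) : Prop :=
  ∃ l : CompTree I (∀ o, dom o), ∀ π : ℕ → Node I, IsTreePath π → π 0 = [] → φ.Sat (trace l π)

/-! ### Nondeterministic Büchi word automata -/

/-- Nondeterministic Büchi word automata. Dead ends are allowed, so that automata with and
without rejecting sink states are covered. -/
structure NBW (α : Type u) (Q : Type w) where
  init : Q
  step : Q → α → Set Q
  final : Set Q

/-- Some run on the word visits some final state infinitely often. -/
def NBW.Accepts {α : Type u} {Q : Type w} (A : NBW α Q) (σ : ℕ → α) : Prop :=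
  ∃ ρ : ℕ → Q, ρ 0 = A.init ∧ (∀ m, ρ (m + 1) ∈ A.step (ρ m) (σ m)) ∧
    ∃ q ∈ A.final, ∃ᶠ m in Filter.atTop, ρ m = q

/-! ### The reduction -/

namespace CTLStar

variable {I : Type u} {O : Type v}

/-- Replace, in a CTL* formula, the maximal subformulas `A φ` by `fA φ` and `E φ` by `fE φ`,
an input `i` by `fi i` and an output `o` by `fo o`. -/
def replace {P : Type w} (fi : I → LTL P) (fo : O → LTL P)
    (fA fE : CTLStar I O .path → LTL P) : {s : Kind} → CTLStar I O s → LTL P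
  | _, .tt => .tt
  | _, .ff => .ff
  | _, .out o => fo o
  | _, .nout o => .neg (fo o)
  | _, .and φ ψ => .and (replace fi fo fA fE φ) (replace fi fo fA fE ψ)
  | _, .or φ ψ => .or (replace fi fo fA fE φ) (replace fi fo fA fE ψ)
  | _, .all φ => fA φ
  | _, .ex φ => fE φ
  | _, .ofState Φ => replace fi fo fA fE Φ
  | _, .inp i => fi i
  | _, .ninp i => .neg (fi i)
  | _, .next φ => .next (replace fi fo fA fE φ)
  | _, .untl φ ψ => .untl (replace fi fo fA fE φ) (replace fi fo fA fE ψ)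
  | _, .release φ ψ => .release (replace fi fo fA fE φ) (replace fi fo fA fE ψ)

/-- The propositions read by the word automata of `Φ`: inputs, outputs, and one proposition
for each quantified subformula of `Φ`. -/
inductive AutProp (Φ : CTLStar I O .state) : Type (max u v)
  | inp (i : I) : AutProp Φ
  | out (o : O) : AutProp Φ
  | univ (φ : {φ // φ ∈ univSub Φ}) : AutProp Φ
  | exist (φ : {φ // φ ∈ existSub Φ}) : AutProp Φ

open Classical in
/-- The LTL formula over `AutProp Φ` obtained from `ψ` by replacing its quantified subformulas
by their propositions. It is only used for subformulas `ψ` of `Φ`, whose quantified subformulas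
are among those of `Φ` (`sub_of_mem_sub`), so the `else` branches are never taken. -/
noncomputable def autFormula (Φ : CTLStar I O .state) {s : Kind} (ψ : CTLStar I O s) :
    LTL (AutProp Φ) :=
  replace (fun i => .atom (.inp i)) (fun o => .atom (.out o))
    (fun φ => if h : φ ∈ univSub Φ then .atom (.univ ⟨φ, h⟩) else .ff)
    (fun φ => if h : φ ∈ existSub Φ then .atom (.exist ⟨φ, h⟩) else .ff) ψ

/-- The outputs of the LTL specification: the original outputs `o`, the propositions `p_{A φ}`,
the numbered variables `v_{E φ}`, and, for each number `j`, one Boolean output for each input,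
which together hold a direction `d_j ∈ 2^I`. -/
inductive ExtOut (Φ : CTLStar I O .state) (k : ℕ) : Type (max u v)
  | orig (o : O) : ExtOut Φ k
  | univ (φ : {φ // φ ∈ univSub Φ}) : ExtOut Φ k
  | exist (φ : {φ // φ ∈ existSub Φ}) : ExtOut Φ k
  | dir (j : Fin k) (i : I) : ExtOut Φ k

/-- Everything is Boolean except the variables `v_{E φ}`, which range over `{0, ..., k}`. -/
abbrev ExtOut.dom {Φ : CTLStar I O .state} {k : ℕ} : ExtOut Φ k → Type
  | .orig _ => Bool
  | .univ _ => Bool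
  | .exist _ => Fin (k + 1)
  | .dir _ _ => Bool

/-- The propositions of the LTL specification. -/
abbrev ExtProp (Φ : CTLStar I O .state) (k : ℕ) : Type (max u v) :=
  IOProp I (ExtOut Φ k) ExtOut.dom

open Classical in
/-- The formula `ψ'` obtained from `ψ` by replacing `A φ` by `p_{A φ}` and `E φ` by
`v_{E φ} ≠ 0`. It is only used for subformulas `ψ` of `Φ`, so the `else` branches are never
taken. -/
noncomputable def prime (Φ : CTLStar I O .state) (k : ℕ) {s : Kind} (ψ : CTLStar I O s) :
    LTL (ExtProp Φ k) :=
  replace (fun i => .atom (.inp i)) (fun o => .atom (.outEq (.orig o) true))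
    (fun φ => if h : φ ∈ univSub Φ then .atom (.outEq (.univ ⟨φ, h⟩) true) else .ff)
    (fun φ => if h : φ ∈ existSub Φ then
      .neg (.atom (.outEq (.exist ⟨φ, h⟩) (0 : Fin (k + 1)))) else .ff) ψ

/-- The current input is the direction `d_j`. -/
noncomputable def followsDir [Fintype I] (Φ : CTLStar I O .state) (k : ℕ) (j : Fin k) :
    LTL (ExtProp Φ k) :=
  LTL.bigAnd fun i : I => .iff (.atom (.inp i)) (.atom (.outEq (.dir j i) true))

/-- `⋀_{j ∈ {1, ..., k}} G [v_{E φ} = j → (G d_j → φ')]`. The numbers `1, ..., k` are indexed by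
`j : Fin k` and are the values `j.succ` of `v_{E φ}`. -/
noncomputable def existClause [Fintype I] (Φ : CTLStar I O .state) (k : ℕ)
    (φ : {φ // φ ∈ existSub Φ}) : LTL (ExtProp Φ k) :=
  LTL.bigAnd fun j : Fin k =>
    .always (.imp (.atom (.outEq (.exist φ) j.succ))
      (.imp (.always (followsDir Φ k j)) (prime Φ k φ.1)))

/-- `G [p_{A φ} → φ']`. -/
noncomputable def univClause (Φ : CTLStar I O .state) (k : ℕ)
    (φ : {φ // φ ∈ univSub Φ}) : LTL (ExtProp Φ k) :=
  .always (.imp (.atom (.outEq (.univ φ) true)) (prime Φ k φ.1))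

/-- The LTL formula derived from `Φ` with `k` numbers. -/
noncomputable def toLTL [Fintype I] (Φ : CTLStar I O .state) (k : ℕ) : LTL (ExtProp Φ k) :=
  .and (prime Φ k Φ)
    (.and (LTL.bigAnd fun φ : {φ // φ ∈ existSub Φ} => existClause Φ k φ)
      (LTL.bigAnd fun φ : {φ // φ ∈ univSub Φ} => univClause Φ k φ))

end CTLStar

end CTLStarSynthesis

namespace CTLStarSynthesis

universe u v w

/-! ### Semantics of the derived LTL operators -/

namespace LTL

variable {P : Type u} {σ : ℕ → Set P} {φ ψ : LTL P}

/-! From the LTL formula to `Φ`: on the paths from a given node, `G d_j` holds on exactly one, the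
path that follows the `j`-th directions. So `v_{E φ} = j` at a node forces `φ'` on that path, which
witnesses `E φ`. Every tree path is a suffix of one from the root, so the clauses bind at every
node, and an induction on formulas (`sat_of_sat_prime`) recovers `Φ`.

From `Φ` to the LTL formula: the difficulty is that `k` direction labellings must serve all nodes at
once, although infinitely many witness paths may pass through the tree. `NBW.exists_memoryless`
fixes one infinite word per node and automaton state so that the tail of a chosen word is again
chosen. Hence at most `k` distinct words matter at a node, whether they start there or come from
above. `exists_directions` colours them injectively with `k` colours, a word inherited from the
parent keeping its colour. The direction labelling `j` takes the first letter of the word coloured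
`j`, so each witness follows a single labelling for ever. -/

theorem sat_or : (or φ ψ).Sat σ ↔ φ.Sat σ ∨ ψ.Sat σ := by
  simp only [or, Sat]; tauto

theorem sat_imp : (imp φ ψ).Sat σ ↔ (φ.Sat σ → ψ.Sat σ) := by
  simp only [imp, sat_or, Sat]; tauto

theorem sat_iff : (iff φ ψ).Sat σ ↔ (φ.Sat σ ↔ ψ.Sat σ) := by
  simp only [iff, sat_imp, Sat]; tauto

theorem sat_always : (always φ).Sat σ ↔ ∀ m, φ.Sat (suffix σ m) := by
  simp [always, eventually, Sat]

theorem sat_release : (release φ ψ).Sat σ ↔ (∀ m, ψ.Sat (suffix σ m)) ∨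
    ∃ m, φ.Sat (suffix σ m) ∧ ∀ j ≤ m, ψ.Sat (suffix σ j) := by
  classical
  simp only [release, Sat]
  constructor
  · intro h
    by_cases hex : ∃ m, φ.Sat (suffix σ m)
    -- The first position satisfying `φ` releases `ψ`: a failure of `ψ` no later than it would be
    -- preceded only by failures of `φ`.
    · refine or_iff_not_imp_left.2 fun hall => ⟨Nat.find hex, Nat.find_spec hex, ?_⟩
      intro j hj
      by_contra hψ
      exact h ⟨j, hψ, fun i hi => Nat.find_min hex (lt_of_lt_of_le hi hj)⟩
    · refine Or.inl fun m => ?_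
      by_contra hψ
      exact h ⟨m, hψ, fun i _ hi => hex ⟨i, hi⟩⟩
  · rintro (h | ⟨m, hm, h⟩) ⟨j, hj, hlt⟩
    · exact hj (h j)
    · rcases le_or_gt j m with hle | hgt
      · exact hj (h j hle)
      · exact hlt m hgt hm

theorem sat_bigAnd {ι : Type w} [Fintype ι] {f : ι → LTL P} :
    (bigAnd f).Sat σ ↔ ∀ a, (f a).Sat σ := by
  have key : ∀ L : List ι,
      (L.foldr (fun a φ => and (f a) φ) tt).Sat σ ↔ ∀ a ∈ L, (f a).Sat σ := by
    intro L
    induction L with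
    | nil => simp [Sat]
    | cons a L ih => simp [Sat, ih]
  simp [bigAnd, key]

end LTL

/-! ### Tree paths -/

/-- The sequence of prefixes of the infinite word `n · t` from `n` on. -/
def pathFrom {α : Type u} (n : List α) (t : ℕ → α) : ℕ → List α
  | 0 => n
  | m + 1 => pathFrom n t m ++ [t m]

theorem suffix_zero {α : Type u} (σ : ℕ → α) : suffix σ 0 = σ := by
  funext j; simp [suffix]

theorem suffix_suffix {α : Type u} (σ : ℕ → α) (m j : ℕ) :
    suffix (suffix σ m) j = suffix σ (m + j) := by
  funext i; simp only [suffix, Nat.add_assoc]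

theorem pathFrom_suffix_one {α : Type u} (n : List α) (t : ℕ → α) (m : ℕ) :
    pathFrom (n ++ [t 0]) (suffix t 1) m = pathFrom n t (m + 1) := by
  induction m with
  | zero => rfl
  | succ m ih => rw [pathFrom, ih, suffix, Nat.add_comm 1 m]; rfl

theorem isTreePath_pathFrom {I : Type u} (n : Node I) (t : ℕ → Set I) :
    IsTreePath (pathFrom n t) := fun m => ⟨t m, rfl⟩

theorem IsTreePath.eq_pathFrom {I : Type u} {π : ℕ → Node I} (h : IsTreePath π) :
    ∃ t, π = pathFrom (π 0) t := by
  choose t ht using h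
  refine ⟨t, funext fun m => ?_⟩
  induction m with
  | zero => rfl
  | succ m ih => rw [ht, pathFrom, ← ih]

theorem IsTreePath.suffix {I : Type u} {π : ℕ → Node I} (h : IsTreePath π) (m : ℕ) :
    IsTreePath (suffix π m) := fun j => h (m + j)

/-- Every tree path is a suffix of a tree path from the root. -/
theorem IsTreePath.exists_root {I : Type u} {π : ℕ → Node I} (h : IsTreePath π) :
    ∃ π' m, IsTreePath π' ∧ π' 0 = [] ∧ CTLStarSynthesis.suffix π' m = π := by
  -- The new path runs through the proper prefixes of `π 0` and then continues as `π`.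
  refine ⟨fun j => if j < (π 0).length then (π 0).take j else π (j - (π 0).length),
    (π 0).length, ?_, ?_, ?_⟩
  · intro j
    rcases lt_trichotomy (j + 1) (π 0).length with hj | hj | hj
    · refine ⟨(π 0)[j], ?_⟩
      simp only [hj, if_true, show j < (π 0).length by omega]
      exact (List.take_append_getElem _).symm
    · refine ⟨(π 0)[j], ?_⟩
      simp only [show ¬ j + 1 < (π 0).length by omega, if_false,
        show j < (π 0).length by omega, if_true, show j + 1 - (π 0).length = 0 by omega]
      rw [List.take_append_getElem, hj, List.take_length]
    · obtain ⟨e, he⟩ := h (j - (π 0).length)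
      refine ⟨e, ?_⟩
      simp only [show ¬ j + 1 < (π 0).length by omega, show ¬ j < (π 0).length by omega, if_false]
      rw [← he]
      congr 1
      omega
  · cases hn : π 0 <;> simp [hn]
  · funext j
    simp [CTLStarSynthesis.suffix]

theorem trace_suffix {I : Type u} {O : Type v} {dom : O → Type} (l : CompTree I (∀ o, dom o))
    (π : ℕ → Node I) (m : ℕ) : suffix (trace l π) m = trace l (suffix π m) := rfl

/-- The path from `n` that takes the direction `D x` out of each node `x`. -/
def follow {I : Type u} (D : Node I → Set I) (n : Node I) : ℕ → Node I
  | 0 => n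
  | m + 1 => follow D n m ++ [D (follow D n m)]

theorem isTreePath_follow {I : Type u} (D : Node I → Set I) (n : Node I) :
    IsTreePath (follow D n) := fun _ => ⟨_, rfl⟩

theorem eq_follow {I : Type u} {D : Node I → Set I} {π : ℕ → Node I}
    (h : ∀ m, π (m + 1) = π m ++ [D (π m)]) : π = follow D (π 0) := by
  funext m
  induction m with
  | zero => rfl
  | succ m ih => rw [h, follow, ← ih]

/-! ### Memoryless witnesses for Büchi acceptance on the paths of a tree -/

/-- Pigeonhole: infinitely many visits to a finite set of final states hit one of them infinitely
often. Acceptance through the whole set suits the distance argument of `NBW.exists_memoryless`. -/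
theorem NBW.accepts_iff {α : Type u} {Q : Type w} [Finite Q] (A : NBW α Q) (σ : ℕ → α) :
    A.Accepts σ ↔ ∃ ρ : ℕ → Q, ρ 0 = A.init ∧ (∀ m, ρ (m + 1) ∈ A.step (ρ m) (σ m)) ∧
      ∃ᶠ m in Filter.atTop, ρ m ∈ A.final := by
  refine exists_congr fun ρ => and_congr_right fun _ => and_congr_right fun _ => ?_
  constructor
  · rintro ⟨q, hq, h⟩
    exact h.mono fun m hm => hm ▸ hq
  · intro h
    by_contra! hno
    have : ∀ᶠ m in Filter.atTop, ∀ q, q ∈ A.final → ρ m ≠ q := by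
      rw [Filter.eventually_all]
      intro q
      by_cases hq : q ∈ A.final
      · filter_upwards [hno q hq] with m hm _ using hm
      · exact Filter.Eventually.of_forall fun m h => absurd h hq
    exact h (this.mono fun m hm hf => hm _ hf rfl)

/-- `ρ` is an accepting run of `A` from `q` on the word that is read along the path from `n`
in the directions `t`, where `lab x e` is the letter read on leaving `x` in direction `e`. -/
def NBW.AcceptingRun {α : Type u} {β : Type v} {Q : Type w} (A : NBW β Q)
    (lab : List α → α → β) (n : List α) (q : Q) (t : ℕ → α) (ρ : ℕ → Q) : Prop :=
  ρ 0 = q ∧ (∀ m, ρ (m + 1) ∈ A.step (ρ m) (lab (pathFrom n t m) (t m))) ∧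
    ∃ᶠ m in Filter.atTop, ρ m ∈ A.final

theorem NBW.AcceptingRun.tail {α : Type u} {β : Type v} {Q : Type w} {A : NBW β Q}
    {lab : List α → α → β} {n : List α} {q : Q} {t : ℕ → α} {ρ : ℕ → Q}
    (h : A.AcceptingRun lab n q t ρ) :
    A.AcceptingRun lab (n ++ [t 0]) (ρ 1) (suffix t 1) (suffix ρ 1) := by
  refine ⟨rfl, fun m => ?_, ?_⟩
  · rw [pathFrom_suffix_one]
    simpa only [suffix, Nat.add_comm 1] using h.2.1 (m + 1)
  · have h3 := h.2.2
    rw [Filter.frequently_atTop] at h3 ⊢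
    intro a
    obtain ⟨b, hb, hf⟩ := h3 (a + 1)
    refine ⟨b - 1, by omega, ?_⟩
    simpa only [suffix, show 1 + (b - 1) = b by omega] using hf

/-- There are witnesses of acceptance, one for each node and state, such that the tail of a
witness is again one of the witnesses. -/
theorem NBW.exists_memoryless {α : Type u} [Inhabited α] {β : Type v} {Q : Type w} (A : NBW β Q)
    (lab : List α → α → β) :
    ∃ W : List α → Q → ℕ → α,
      (∀ n q, ∃ q', suffix (W n q) 1 = W (n ++ [W n q 0]) q') ∧
      ∀ n q, (∃ t ρ, A.AcceptingRun lab n q t ρ) → ∃ ρ, A.AcceptingRun lab n q (W n q) ρ := by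
  classical
  let Win : List α → Q → Prop := fun n q => ∃ t ρ, A.AcceptingRun lab n q t ρ
  -- The offset in `ρ (d + 1)` counts only final states strictly after the current one, so the
  -- countdown restarts after each visit. The set is empty exactly where `Win` fails, and there the
  -- value is irrelevant.
  let dist : List α → Q → ℕ := fun n q =>
    sInf {d | ∃ t ρ, A.AcceptingRun lab n q t ρ ∧ ρ (d + 1) ∈ A.final}
  -- A move that depends on node and state alone: the first step of a run attaining `dist`. Unless
  -- that step already reaches a final state, the tail of the run bounds the next distance by one
  -- less.
  have hstep : ∀ n q, ∃ c : α × Q, Win n q → c.2 ∈ A.step q (lab n c.1) ∧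
      Win (n ++ [c.1]) c.2 ∧ (c.2 ∈ A.final ∨ dist (n ++ [c.1]) c.2 < dist n q) := by
    intro n q
    by_cases hw : Win n q
    · have hne : {d | ∃ t ρ, A.AcceptingRun lab n q t ρ ∧ ρ (d + 1) ∈ A.final}.Nonempty := by
        obtain ⟨t, ρ, h⟩ := hw
        obtain ⟨b, hb, hf⟩ := Filter.frequently_atTop.1 h.2.2 1
        exact ⟨b - 1, t, ρ, h, by rwa [Nat.sub_add_cancel hb]⟩
      obtain ⟨t, ρ, h, hf⟩ := Nat.sInf_mem hne
      change ρ (dist n q + 1) ∈ _ at hf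
      refine ⟨(t 0, ρ 1), fun _ => ⟨?_, ⟨_, _, h.tail⟩, ?_⟩⟩
      · have := h.2.1 0
        rwa [h.1] at this
      · rcases Nat.eq_zero_or_pos (dist n q) with h0 | hpos
        · rw [h0] at hf
          exact Or.inl hf
        · refine Or.inr (lt_of_le_of_lt (Nat.sInf_le (m := dist n q - 1) ?_)
            (Nat.sub_lt hpos one_pos))
          refine ⟨_, _, h.tail, ?_⟩
          simpa only [suffix, show 1 + (dist n q - 1 + 1) = dist n q + 1 by omega] using hf
    -- Losing configurations get an arbitrary move, so the tail property of `W` needs no winning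
    -- hypothesis.
    · exact ⟨(default, q), fun h => absurd h hw⟩
  choose c hc using hstep
  let next : List α × Q → List α × Q := fun x => (x.1 ++ [(c x.1 x.2).1], (c x.1 x.2).2)
  let cfg : List α → Q → ℕ → List α × Q := fun n q m => next^[m] (n, q)
  have cfg_succ : ∀ n q m, cfg n q (m + 1) = next (cfg n q m) := fun n q m =>
    Function.iterate_succ_apply' next m (n, q)
  let W : List α → Q → ℕ → α := fun n q m => (c (cfg n q m).1 (cfg n q m).2).1
  have hpath : ∀ n q m, pathFrom n (W n q) m = (cfg n q m).1 := by
    intro n q m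
    induction m with
    | zero => rfl
    | succ m ih => rw [pathFrom, ih, cfg_succ]
  refine ⟨W, fun n q => ⟨(c n q).2, ?_⟩, fun n q hw => ⟨fun m => (cfg n q m).2, rfl, ?_, ?_⟩⟩
  · have h1 : ∀ m, cfg n q (1 + m) = cfg (n ++ [(c n q).1]) (c n q).2 m := by
      intro m
      rw [Nat.add_comm]
      exact Function.iterate_succ_apply next m (n, q)
    funext m
    simp only [suffix, W, h1]
    rfl
  all_goals
    have hwin : ∀ m, Win (cfg n q m).1 (cfg n q m).2 := by
      intro m
      induction m with
      | zero => exact hw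
      | succ m ih =>
        rw [cfg_succ]
        exact (hc _ _ ih).2.1
  · intro m
    beta_reduce
    rw [hpath, cfg_succ]
    exact (hc _ _ (hwin m)).1
  -- `dist` cannot decrease for ever, so a final state occurs after every position.
  · have hreach : ∀ d m, dist (cfg n q m).1 (cfg n q m).2 = d →
        ∃ b ≥ m, (cfg n q b).2 ∈ A.final := by
      intro d
      induction d using Nat.strong_induction_on with
      | _ d ih =>
        intro m hm
        rcases (hc _ _ (hwin m)).2.2 with hf | hlt
        · exact ⟨m + 1, Nat.le_succ m, by rw [cfg_succ]; exact hf⟩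
        · obtain ⟨b, hb, hf⟩ := ih (dist (cfg n q (m + 1)).1 (cfg n q (m + 1)).2)
            (by rw [cfg_succ, ← hm]; exact hlt) (m + 1) rfl
          exact ⟨b, by omega, hf⟩
    rw [Filter.frequently_atTop]
    exact fun a => hreach _ a rfl

/-! ### Bundling witnesses into finitely many direction labellings -/

/-- Choice of node labels along the words over `α`, each depending on the label of the parent. -/
theorem exists_labelling {α : Type u} {X : Type v} {Good : List α → X → Prop}
    {Step : List α → α → X → X → Prop} (h0 : ∃ x, Good [] x)
    (hs : ∀ n e x, Good n x → ∃ y, Good (n ++ [e]) y ∧ Step n e x y) :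
    ∃ F : List α → X, (∀ n, Good n (F n)) ∧ ∀ n e, Step n e (F n) (F (n ++ [e])) := by
  classical
  obtain ⟨x₀, hx₀⟩ := h0
  have : ∀ n e x, ∃ y, Good n x → Good (n ++ [e]) y ∧ Step n e x y := by
    intro n e x
    by_cases h : Good n x
    · obtain ⟨y, hy⟩ := hs n e x h
      exact ⟨y, fun _ => hy⟩
    · exact ⟨x, fun h' => absurd h' h⟩
  choose f hf using this
  -- The fold carries the current node beside its label, since the choice `f` depends on both.
  let G : List α → List α × X := fun n =>
    n.foldl (fun p e => (p.1 ++ [e], f p.1 e p.2)) ([], x₀)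
  have G_append : ∀ n e, G (n ++ [e]) = ((G n).1 ++ [e], f (G n).1 e (G n).2) := by
    intro n e
    simp [G, List.foldl_append]
  have G_fst : ∀ n, (G n).1 = n := by
    intro n
    induction n using List.reverseRecOn with
    | nil => rfl
    | append_singleton n e ih => rw [G_append, ih]
  have G_good : ∀ n, Good n (G n).2 := by
    intro n
    induction n using List.reverseRecOn with
    | nil => exact hx₀
    | append_singleton n e ih => rw [G_append, G_fst]; exact (hf n e _ ih).1
  refine ⟨fun n => (G n).2, G_good, fun n e => ?_⟩
  simp only [G_append, G_fst]
  exact (hf n e _ (G_good n)).2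

/-- An injective function on a subset of a set with at most `k` elements extends to the set. -/
theorem exists_injOn_extension {X : Type u} {k : ℕ} {S T : Set X} (hST : S ⊆ T)
    (hT : ∃ f : Fin k → X, T ⊆ Set.range f) {g : X → Fin k} (hg : Set.InjOn g S) :
    ∃ g' : X → Fin k, Set.InjOn g' T ∧ Set.EqOn g' g S := by
  classical
  obtain ⟨f, hf⟩ := hT
  have hfin : T.Finite := (Set.finite_range f).subset hf
  have hcard : T.encard ≤ k := by
    calc T.encard ≤ (Set.range f).encard := Set.encard_le_encard hf
      _ ≤ (Set.univ : Set (Fin k)).encard := by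
        rw [← Set.image_univ]; exact Set.encard_image_le f _
      _ = k := by simp
  -- The values unused by `g` on `S` number `k - |S|`, enough for the rest of `T`.
  have hle : (T \ S).encard ≤ ((g '' S)ᶜ).encard := by
    have h1 := Set.encard_sdiff_add_encard_of_subset hST
    have h2 := Set.encard_add_encard_compl (g '' S)
    rw [hg.encard_image] at h2
    have h3 : S.encard ≠ ⊤ := (hfin.subset hST).encard_lt_top.ne
    have h4 : (Set.univ : Set (Fin k)).encard = k := by simp
    rw [h4] at h2
    refine (ENat.add_le_add_iff_right h3).1 ?_
    rw [h1, add_comm, h2]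
    exact hcard
  -- For `k = 0` the map `g` leaves `X` empty; otherwise the codomain is nonempty, as the choice of
  -- `h` requires.
  rcases k with _ | k
  · refine ⟨g, fun x hx => ?_, fun _ _ => rfl⟩
    exact (g x).elim0
  obtain ⟨h, hmaps, hinj⟩ := (hfin.subset Set.sdiff_subset).exists_injOn_of_encard_le hle
  refine ⟨S.piecewise g h, ?_, Set.piecewise_eqOn S g h⟩
  intro x hx y hy hxy
  by_cases hxS : x ∈ S <;> by_cases hyS : y ∈ S <;>
    simp only [Set.piecewise, hxS, hyS, if_true, if_false] at hxy
  · exact hg hxS hyS hxy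
  · exact absurd ⟨x, hxS, hxy⟩ (hmaps ⟨hy, hyS⟩)
  · exact absurd ⟨y, hyS, hxy.symm⟩ (hmaps ⟨hx, hxS⟩)
  · exact hinj ⟨hx, hxS⟩ ⟨hy, hyS⟩ hxy

/-- If at most `k` infinite words are given at each node, closed under passing to the tail at
the corresponding child, then each of them is followed by one of `k` direction labellings. -/
theorem exists_directions {α : Type u} [Inhabited α] {k : ℕ} (T : List α → Set (ℕ → α))
    (hT : ∀ n, ∃ f : Fin k → ℕ → α, T n ⊆ Set.range f)
    (htail : ∀ n, ∀ t ∈ T n, suffix t 1 ∈ T (n ++ [t 0])) :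
    ∃ D : List α → Fin k → α, ∀ n, ∀ t ∈ T n, ∃ j, ∀ m, D (pathFrom n t m) j = t m := by
  classical
  rcases Nat.eq_zero_or_pos k with rfl | hk
  · refine ⟨fun _ j => j.elim0, fun n t ht => ?_⟩
    obtain ⟨f, hf⟩ := hT n
    obtain ⟨j, _⟩ := hf ht
    exact j.elim0
  let cons : α → (ℕ → α) → ℕ → α := fun e t m => Nat.casesOn m e t
  have cons_inj : ∀ e t t', cons e t = cons e t' → t = t' := fun e t t' h =>
    funext fun m => congrFun h (m + 1)
  have cons_eta : ∀ t : ℕ → α, cons (t 0) (suffix t 1) = t := by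
    intro t
    funext m
    cases m with
    | zero => rfl
    | succ m => simp only [cons, suffix, Nat.add_comm 1]
  -- Each node carries an injective colouring of its words, and a tail of a word at the parent keeps
  -- the colour of that word.
  obtain ⟨col, hinj, hcol⟩ := exists_labelling (X := (ℕ → α) → Fin k)
    (Good := fun n g => Set.InjOn g (T n))
    (Step := fun n e g g' => ∀ t ∈ T (n ++ [e]), cons e t ∈ T n → g' t = g (cons e t))
    (by
      obtain ⟨g, hg, _⟩ := exists_injOn_extension (Set.empty_subset _) (hT [])
        (g := fun _ => ⟨0, hk⟩) (Set.injOn_empty _)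
      exact ⟨g, hg⟩)
    (by
      intro n e g hg
      -- Inherited colours are distinct because prepending `e` is injective; words that start afresh
      -- at the child get the free colours.
      obtain ⟨g', hg', heq⟩ := exists_injOn_extension
        (S := {t | t ∈ T (n ++ [e]) ∧ cons e t ∈ T n}) (fun t ht => ht.1) (hT (n ++ [e]))
        (g := fun t => g (cons e t))
        (fun t ht t' ht' h => cons_inj e _ _ (hg ht.2 ht'.2 h))
      exact ⟨g', hg', fun t h1 h2 => heq ⟨h1, h2⟩⟩)
  -- By injectivity at most one word at `n` has colour `j`; unused colours get the default letter.
  refine ⟨fun n j => if h : ∃ t ∈ T n, col n t = j then h.choose 0 else default, ?_⟩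
  have hD : ∀ n, ∀ t ∈ T n,
      (if h : ∃ t' ∈ T n, col n t' = col n t then h.choose 0 else default) = t 0 := by
    intro n t ht
    have h : ∃ t' ∈ T n, col n t' = col n t := ⟨t, ht, rfl⟩
    rw [dif_pos h, hinj n h.choose_spec.1 ht h.choose_spec.2]
  intro n t ht
  refine ⟨col n t, fun m => ?_⟩
  induction m generalizing n t with
  | zero => exact hD n t ht
  | succ m ih =>
    have h1 := htail n t ht
    have h2 : col (n ++ [t 0]) (suffix t 1) = col n t := by
      rw [hcol n (t 0) _ h1 (by rwa [cons_eta]), cons_eta]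
    have h3 := ih (n ++ [t 0]) (suffix t 1) h1
    rw [h2, pathFrom_suffix_one] at h3
    rw [h3, suffix, Nat.add_comm]

namespace CTLStar

variable {I : Type u} {O : Type v}

/-- The point of a tree path at which a formula of the given kind is evaluated. -/
def pointOf (π : ℕ → Node I) : (s : Kind) → Point I s
  | .state => π 0
  | .path => π

theorem sat_ninp_iff {l : CompTree I (Set O)} {π : ℕ → Node I} (hπ : IsTreePath π) (i : I) :
    Sat l (.ninp i) π ↔ ¬ Sat l (.inp i) π := by
  obtain ⟨e, he⟩ := hπ 0
  simp only [Nat.zero_add] at he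
  simp [Sat, he]

/-- If the replacements of the atoms and of the quantified subformulas of `ψ` are correct along
a tree path, then so is the replacement of `ψ`. -/
theorem sat_replace_iff {P : Type w} {fi : I → LTL P} {fo : O → LTL P}
    {fA fE : CTLStar I O .path → LTL P} {l : CompTree I (Set O)} {s : Kind} (ψ : CTLStar I O s) :
    ∀ {π : ℕ → Node I} {σ : ℕ → Set P}, IsTreePath π →
      (∀ i m, (fi i).Sat (suffix σ m) ↔ Sat l (.inp i) (suffix π m)) →
      (∀ o m, (fo o).Sat (suffix σ m) ↔ Sat l (.out o) (π m)) →
      (∀ φ ∈ univSub ψ, ∀ m, (fA φ).Sat (suffix σ m) ↔ Sat l (.all φ) (π m)) →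
      (∀ φ ∈ existSub ψ, ∀ m, (fE φ).Sat (suffix σ m) ↔ Sat l (.ex φ) (π m)) →
      ((replace fi fo fA fE ψ).Sat σ ↔ Sat l ψ (pointOf π s)) := by
  induction ψ with
  | tt => intros; rfl
  | ff => intros; rfl
  | out o =>
    intro π σ _ _ ho _ _
    simpa only [suffix_zero] using! ho o 0
  | nout o =>
    intro π σ _ _ ho _ _
    exact not_congr (by simpa only [suffix_zero] using! ho o 0)
  | and φ ψ ih₁ ih₂ =>
    intro π σ hπ hi ho hA hE
    simp only [univSub, existSub, Finset.mem_union] at hA hE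
    exact and_congr (ih₁ hπ hi ho (fun φ h => hA φ (.inl h)) (fun φ h => hE φ (.inl h)))
      (ih₂ hπ hi ho (fun φ h => hA φ (.inr h)) (fun φ h => hE φ (.inr h)))
  | or φ ψ ih₁ ih₂ =>
    intro π σ hπ hi ho hA hE
    simp only [univSub, existSub, Finset.mem_union] at hA hE
    rw [replace, LTL.sat_or]
    exact or_congr (ih₁ hπ hi ho (fun φ h => hA φ (.inl h)) (fun φ h => hE φ (.inl h)))
      (ih₂ hπ hi ho (fun φ h => hA φ (.inr h)) (fun φ h => hE φ (.inr h)))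
  | all φ ih =>
    intro π σ _ _ _ hA _
    simpa only [suffix_zero] using! hA φ (by simp [univSub]) 0
  | ex φ ih =>
    intro π σ _ _ _ _ hE
    simpa only [suffix_zero] using! hE φ (by simp [existSub]) 0
  | ofState Φ ih =>
    intro π σ hπ hi ho hA hE
    exact ih hπ hi ho hA hE
  | inp i =>
    intro π σ _ hi _ _ _
    simpa only [suffix_zero] using! hi i 0
  | ninp i =>
    intro π σ hπ hi _ _ _
    refine Iff.trans (not_congr ?_) (sat_ninp_iff hπ i).symm
    simpa only [suffix_zero] using! hi i 0
  | next φ ih =>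
    intro π σ hπ hi ho hA hE
    exact ih (π := suffix π 1) (hπ.suffix 1)
      (fun i j => by rw [suffix_suffix, suffix_suffix]; exact hi i _)
      (fun o j => by rw [suffix_suffix]; exact ho o _)
      (fun φ h j => by rw [suffix_suffix]; exact hA φ h _)
      (fun φ h j => by rw [suffix_suffix]; exact hE φ h _)
  | untl φ ψ ih₁ ih₂ =>
    intro π σ hπ hi ho hA hE
    simp only [univSub, existSub, Finset.mem_union] at hA hE
    have h₁ := fun m => ih₁ (π := suffix π m) (σ := suffix σ m) (hπ.suffix m)
      (fun i j => by rw [suffix_suffix, suffix_suffix]; exact hi i _)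
      (fun o j => by rw [suffix_suffix]; exact ho o _)
      (fun φ h j => by rw [suffix_suffix]; exact hA φ (.inl h) _)
      (fun φ h j => by rw [suffix_suffix]; exact hE φ (.inl h) _)
    have h₂ := fun m => ih₂ (π := suffix π m) (σ := suffix σ m) (hπ.suffix m)
      (fun i j => by rw [suffix_suffix, suffix_suffix]; exact hi i _)
      (fun o j => by rw [suffix_suffix]; exact ho o _)
      (fun φ h j => by rw [suffix_suffix]; exact hA φ (.inr h) _)
      (fun φ h j => by rw [suffix_suffix]; exact hE φ (.inr h) _)
    simp only [replace, LTL.Sat, Sat, pointOf, h₁, h₂]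
  | release φ ψ ih₁ ih₂ =>
    intro π σ hπ hi ho hA hE
    simp only [univSub, existSub, Finset.mem_union] at hA hE
    have h₁ := fun m => ih₁ (π := suffix π m) (σ := suffix σ m) (hπ.suffix m)
      (fun i j => by rw [suffix_suffix, suffix_suffix]; exact hi i _)
      (fun o j => by rw [suffix_suffix]; exact ho o _)
      (fun φ h j => by rw [suffix_suffix]; exact hA φ (.inl h) _)
      (fun φ h j => by rw [suffix_suffix]; exact hE φ (.inl h) _)
    have h₂ := fun m => ih₂ (π := suffix π m) (σ := suffix σ m) (hπ.suffix m)
      (fun i j => by rw [suffix_suffix, suffix_suffix]; exact hi i _)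
      (fun o j => by rw [suffix_suffix]; exact ho o _)
      (fun φ h j => by rw [suffix_suffix]; exact hA φ (.inr h) _)
      (fun φ h j => by rw [suffix_suffix]; exact hE φ (.inr h) _)
    simp only [replace, LTL.sat_release, Sat, pointOf, h₁, h₂]

/-! ### From the LTL specification to CTL* -/

section Soundness

variable {Φ : CTLStar I O .state} {k : ℕ} {l : CompTree I (∀ o : ExtOut Φ k, o.dom)}

/-- A clause `G χ` that holds on all paths from the root makes `χ` hold on every tree path. -/
theorem sat_of_always {χ : LTL (ExtProp Φ k)}
    (h : ∀ π, IsTreePath π → π 0 = [] → χ.always.Sat (trace l π))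
    {π : ℕ → Node I} (hπ : IsTreePath π) : χ.Sat (trace l π) := by
  obtain ⟨π', m, hπ', h0, rfl⟩ := hπ.exists_root
  rw [← trace_suffix]
  exact LTL.sat_always.1 (h π' hπ' h0) m

theorem sat_followsDir [Fintype I] {j : Fin k} {π : ℕ → Node I} (hπ : IsTreePath π) :
    (followsDir Φ k j).Sat (trace l π) ↔ π 1 = π 0 ++ [{i | l (π 0) (.dir j i) = true}] := by
  obtain ⟨e, he⟩ := hπ 0
  simp only [Nat.zero_add] at he
  have hi : ∀ i, (IOProp.inp i ∈ trace l π 0) ↔ i ∈ e := by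
    intro i
    change (∃ e', π 1 = π 0 ++ [e'] ∧ i ∈ e') ↔ _
    simp [he]
  simp only [followsDir, LTL.sat_bigAnd, LTL.sat_iff, LTL.Sat, hi, he,
    List.append_cancel_left_eq, List.cons.injEq, and_true, Set.ext_iff]
  exact Iff.rfl

/-- This turns the premise `G d_j` into equality with one path, so that an existential clause speaks
of a single witness. -/
theorem sat_always_followsDir [Fintype I] {j : Fin k} {π : ℕ → Node I} (hπ : IsTreePath π) :
    (followsDir Φ k j).always.Sat (trace l π) ↔
      π = follow (fun n => {i | l n (.dir j i) = true}) (π 0) := by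
  rw [LTL.sat_always]
  simp only [trace_suffix, sat_followsDir (hπ.suffix _)]
  constructor
  · exact fun h => eq_follow h
  · intro h m
    change π (m + 1) = π m ++ [{i | l (π m) (.dir j i) = true}]
    rw [h]
    rfl

/-- The original outputs of a tree labelled with the extended outputs. -/
def origTree (l : CompTree I (∀ o : ExtOut Φ k, o.dom)) : CompTree I (Set O) :=
  fun n => {o | l n (.orig o) = true}

/-- Only one implication is available, as a clause says nothing when `p_{A φ}` is false or `v_{E φ}
= 0`. It suffices by positive normal form: negation is applied only to inputs and outputs, never to
a quantified subformula. -/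
theorem sat_of_sat_prime [Fintype I]
    (hE : ∀ φ π, IsTreePath π → π 0 = [] → (existClause Φ k φ).Sat (trace l π))
    (hA : ∀ φ π, IsTreePath π → π 0 = [] → (univClause Φ k φ).Sat (trace l π))
    {s : Kind} (ψ : CTLStar I O s) :
    existSub ψ ⊆ existSub Φ → univSub ψ ⊆ univSub Φ → ∀ {π : ℕ → Node I}, IsTreePath π →
      (prime Φ k ψ).Sat (trace l π) → Sat (origTree l) ψ (pointOf π s) := by
  induction ψ with
  | tt => intros; trivial
  | ff => intro _ _ _ _ h; exact h
  | out o => intro _ _ _ _ h; exact h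
  | nout o => intro _ _ _ _ h; exact h
  | and φ ψ ih₁ ih₂ =>
    intro h₁ h₂ π hπ h
    simp only [existSub, univSub, Finset.union_subset_iff] at h₁ h₂
    exact ⟨ih₁ h₁.1 h₂.1 hπ h.1, ih₂ h₁.2 h₂.2 hπ h.2⟩
  | or φ ψ ih₁ ih₂ =>
    intro h₁ h₂ π hπ h
    simp only [existSub, univSub, Finset.union_subset_iff] at h₁ h₂
    exact (LTL.sat_or.1 h).imp (ih₁ h₁.1 h₂.1 hπ) (ih₂ h₁.2 h₂.2 hπ)
  | all φ ih =>
    intro h₁ h₂ π hπ h π' hπ' h0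
    simp only [existSub, univSub, Finset.insert_subset_iff] at h₁ h₂
    refine ih h₁ h₂.2 hπ' (LTL.sat_imp.1 (sat_of_always (hA ⟨φ, h₂.1⟩) hπ') ?_)
    simp only [prime, replace, dif_pos h₂.1] at h
    change l (π' 0) (.univ ⟨φ, h₂.1⟩) = true
    rw [h0]
    exact h
  | ex φ ih =>
    intro h₁ h₂ π hπ h
    simp only [existSub, univSub, Finset.insert_subset_iff] at h₁ h₂
    simp only [prime, replace, dif_pos h₁.1] at h
    -- A nonzero value of `v_{E φ}` is some `j.succ`; the witness is the path along the `j`-th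
    -- directions.
    obtain ⟨j, hj⟩ := Fin.exists_succ_eq.2
      (show l (π 0) (.exist ⟨φ, h₁.1⟩) ≠ (0 : Fin (k + 1)) from h)
    have hf := isTreePath_follow (fun n => {i | l n (.dir j i) = true}) (π 0)
    refine ⟨_, hf, rfl, ih h₁.2 h₂ hf ?_⟩
    have hc := sat_of_always (χ := .imp (.atom (.outEq (.exist ⟨φ, h₁.1⟩) j.succ))
      (.imp (.always (followsDir Φ k j)) (prime Φ k φ)))
      (fun π hπ h0 => LTL.sat_bigAnd.1 (hE ⟨φ, h₁.1⟩ π hπ h0) j) hf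
    exact LTL.sat_imp.1 (LTL.sat_imp.1 hc hj.symm) ((sat_always_followsDir hf).2 rfl)
  | ofState Ψ ih => intro h₁ h₂ π hπ h; exact ih h₁ h₂ hπ h
  | inp i => intro _ _ _ _ h; exact h
  | ninp i => intro _ _ π hπ h; exact (sat_ninp_iff hπ i).2 h
  | next φ ih => intro h₁ h₂ π hπ h; exact ih h₁ h₂ (hπ.suffix 1) h
  | untl φ ψ ih₁ ih₂ =>
    intro h₁ h₂ π hπ h
    simp only [existSub, univSub, Finset.union_subset_iff] at h₁ h₂
    obtain ⟨m, hm, hj⟩ := h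
    exact ⟨m, ih₂ h₁.2 h₂.2 (hπ.suffix m) hm, fun j h => ih₁ h₁.1 h₂.1 (hπ.suffix j) (hj j h)⟩
  | release φ ψ ih₁ ih₂ =>
    intro h₁ h₂ π hπ h
    simp only [existSub, univSub, Finset.union_subset_iff] at h₁ h₂
    rcases LTL.sat_release.1 h with hall | ⟨m, hm, hj⟩
    · exact Or.inl fun m => ih₂ h₁.2 h₂.2 (hπ.suffix m) (hall m)
    · exact Or.inr ⟨m, ih₁ h₁.1 h₂.1 (hπ.suffix m) hm,
        fun j h => ih₂ h₁.2 h₂.2 (hπ.suffix j) (hj j h)⟩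

theorem realisable_of_toLTL [Fintype I] (h : (toLTL Φ k).Realisable) : Φ.Realisable := by
  obtain ⟨l, hl⟩ := h
  refine ⟨origTree l, ?_⟩
  -- Any path from the root will do, since a state formula is evaluated at its first node only.
  exact sat_of_sat_prime
    (fun φ π hπ h0 => LTL.sat_bigAnd.1 (hl π hπ h0).2.1 φ)
    (fun φ π hπ h0 => LTL.sat_bigAnd.1 (hl π hπ h0).2.2 φ)
    Φ (Finset.Subset.refl _) (Finset.Subset.refl _) (isTreePath_pathFrom [] fun _ => ∅)
    (hl _ (isTreePath_pathFrom [] fun _ => ∅) rfl).1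

end Soundness

/-! ### From CTL* to the LTL specification -/

section Completeness

variable {Φ : CTLStar I O .state} {l : CompTree I (Set O)}

/-- The letter read by the word automata when leaving `n` in direction `e`, where quantified
subformulas are given their truth values at `n`. -/
def autLetter (Φ : CTLStar I O .state) (l : CompTree I (Set O)) (n : Node I) (e : Set I) :
    Set Φ.AutProp :=
  {p | match p with
    | .inp i => i ∈ e
    | .out o => o ∈ l n
    | .univ φ => Sat l (.all φ.1) n
    | .exist φ => Sat l (.ex φ.1) n}

theorem sat_autFormula_iff {ψ : CTLStar I O .path} (h₁ : existSub ψ ⊆ existSub Φ)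
    (h₂ : univSub ψ ⊆ univSub Φ) (n : Node I) (t : ℕ → Set I) :
    (autFormula Φ ψ).Sat (fun m => autLetter Φ l (pathFrom n t m) (t m)) ↔
      Sat l ψ (pathFrom n t) := by
  refine sat_replace_iff ψ (isTreePath_pathFrom n t) ?_ ?_ ?_ ?_
  · intro i m
    have : suffix (pathFrom n t) m 1 = pathFrom n t m ++ [t m] := rfl
    simp only [Sat, this]
    change i ∈ t m ↔ _
    simp [suffix]
  · exact fun o m => Iff.rfl
  · intro φ hφ m
    rw [dif_pos (h₂ hφ)]
    exact Iff.rfl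
  · intro φ hφ m
    rw [dif_pos (h₁ hφ)]
    exact Iff.rfl

/-- Finitely many direction labellings, as many as the automata have states, provide witnesses
for all existential subformulas at all nodes. -/
theorem exists_witness_directions {Q : {φ // φ ∈ Φ.existSub} → Type w} [∀ φ, Fintype (Q φ)]
    (A : ∀ φ : {φ // φ ∈ Φ.existSub}, NBW (Set Φ.AutProp) (Q φ))
    (hA : ∀ (φ : {φ // φ ∈ Φ.existSub}) (σ : ℕ → Set Φ.AutProp),
      (A φ).Accepts σ ↔ (Φ.autFormula φ.1).Sat σ)
    (l : CompTree I (Set O)) :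
    ∃ D : Node I → Fin (∑ φ, Fintype.card (Q φ)) → Set I,
      ∀ φ : {φ // φ ∈ Φ.existSub}, ∀ n, Sat l (.ex φ.1) n →
        ∃ j, Sat l φ.1 (follow (fun x => D x j) n) := by
  classical
  choose W hWtail hW using fun φ => (A φ).exists_memoryless (autLetter Φ l)
  -- All pairs of an automaton and a state are counted: witnesses start in initial states, but their
  -- tails belong to other states.
  have e : Fin (∑ φ, Fintype.card (Q φ)) ≃ Σ φ, Q φ :=
    (finCongr Fintype.card_sigma.symm).trans (Fintype.equivFin _).symm
  obtain ⟨D, hD⟩ := exists_directions (k := ∑ φ, Fintype.card (Q φ))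
    (fun n => Set.range fun x : Σ φ, Q φ => W x.1 n x.2)
    (fun n => ⟨fun j => W (e j).1 n (e j).2, by
      rintro _ ⟨x, rfl⟩
      exact ⟨e.symm x, by beta_reduce; rw [e.apply_symm_apply]⟩⟩)
    (by
      rintro n _ ⟨x, rfl⟩
      obtain ⟨q', hq'⟩ := hWtail x.1 n x.2
      exact ⟨⟨x.1, q'⟩, hq'.symm⟩)
  refine ⟨D, fun φ n ⟨π, hπ, h0, hsat⟩ => ?_⟩
  obtain ⟨h₁, h₂⟩ := (sub_of_mem_sub Φ).1 φ.1 φ.2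
  obtain ⟨t, ht⟩ := hπ.eq_pathFrom
  -- The given witness path is only used to see that the initial state is winning; the chosen word
  -- from there replaces it.
  rw [ht, h0, ← sat_autFormula_iff h₁ h₂, ← hA φ, NBW.accepts_iff] at hsat
  obtain ⟨ρ, hρ⟩ := hsat
  obtain ⟨ρ', hρ'⟩ := hW φ n (A φ).init ⟨t, ρ, hρ⟩
  have hacc : Sat l φ.1 (pathFrom n (W φ n (A φ).init)) := by
    rw [← sat_autFormula_iff h₁ h₂, ← hA φ, NBW.accepts_iff]
    exact ⟨ρ', hρ'⟩
  obtain ⟨j, hj⟩ := hD n _ ⟨⟨φ, (A φ).init⟩, rfl⟩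
  refine ⟨j, ?_⟩
  have : pathFrom n (W φ n (A φ).init) = follow (fun x => D x j) n :=
    eq_follow (π := pathFrom n (W φ n (A φ).init)) fun m => by
      rw [hj m]
      rfl
  rwa [this] at hacc

variable {k : ℕ}

open Classical in
/-- The labelling with the extended outputs determined by a tree and `k` direction labellings:
`p_{A φ}` is the truth value of `A φ`, and `v_{E φ}` is the number of a direction labelling
that leads along a path satisfying `φ`, if there is one. -/
noncomputable def extTree (Φ : CTLStar I O .state) (l : CompTree I (Set O))
    (D : Node I → Fin k → Set I) : CompTree I (∀ o : ExtOut Φ k, o.dom) := fun n o =>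
  match o with
  | .orig o => decide (o ∈ l n)
  | .univ φ => decide (Sat l (.all φ.1) n)
  | .exist φ =>
    if h : ∃ j, Sat l φ.1 (follow (fun x => D x j) n) then h.choose.succ else (0 : Fin (k + 1))
  | .dir j i => decide (i ∈ D n j)

theorem extTree_dir (D : Node I → Fin k → Set I) (n : Node I) (j : Fin k) :
    {i | extTree Φ l D n (.dir j i) = true} = D n j := by
  ext i
  simp [extTree]

/-- Here the replacement is exact, as `p_{A φ}` and `v_{E φ} ≠ 0` record truth values; `hD` ensures
that a true `E φ` receives a nonzero number. -/
theorem sat_prime_extTree {D : Node I → Fin k → Set I}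
    (hD : ∀ φ : {φ // φ ∈ Φ.existSub}, ∀ n, Sat l (.ex φ.1) n →
      ∃ j, Sat l φ.1 (follow (fun x => D x j) n))
    {s : Kind} {ψ : CTLStar I O s} (h₁ : existSub ψ ⊆ existSub Φ)
    (h₂ : univSub ψ ⊆ univSub Φ) {π : ℕ → Node I} (hπ : IsTreePath π) :
    (prime Φ k ψ).Sat (trace (extTree Φ l D) π) ↔ Sat l ψ (pointOf π s) := by
  classical
  refine sat_replace_iff ψ hπ (fun i m => Iff.rfl) ?_ ?_ ?_
  · intro o m
    exact decide_eq_true_iff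
  · intro φ hφ m
    rw [dif_pos (h₂ hφ)]
    exact decide_eq_true_iff
  · intro φ hφ m
    rw [dif_pos (h₁ hφ)]
    change ¬ (extTree Φ l D (π m) (.exist ⟨φ, h₁ hφ⟩) = (0 : Fin (k + 1))) ↔ _
    by_cases h : ∃ j, Sat l φ (follow (fun x => D x j) (π m))
    · simp only [extTree, dif_pos h, Fin.succ_ne_zero, not_false_eq_true, true_iff]
      obtain ⟨j, hj⟩ := h
      exact ⟨_, isTreePath_follow _ _, rfl, hj⟩
    · simp only [extTree, dif_neg h, not_true_eq_false, false_iff]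
      exact fun h' => h (hD ⟨φ, h₁ hφ⟩ _ h')

theorem toLTL_realisable [Fintype I] {D : Node I → Fin k → Set I}
    (hD : ∀ φ : {φ // φ ∈ Φ.existSub}, ∀ n, Sat l (.ex φ.1) n →
      ∃ j, Sat l φ.1 (follow (fun x => D x j) n))
    (h : Sat l Φ []) : (toLTL Φ k).Realisable := by
  classical
  refine ⟨extTree Φ l D, fun π hπ h0 => ⟨?_, LTL.sat_bigAnd.2 fun φ =>
    LTL.sat_bigAnd.2 fun j => LTL.sat_always.2 fun m => ?_, LTL.sat_bigAnd.2 fun φ =>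
    LTL.sat_always.2 fun m => ?_⟩⟩
  · rw [sat_prime_extTree hD (Finset.Subset.refl _) (Finset.Subset.refl _) hπ]
    simpa only [pointOf, h0] using! h
  · obtain ⟨h₁, h₂⟩ := (sub_of_mem_sub Φ).1 φ.1 φ.2
    rw [trace_suffix, LTL.sat_imp, LTL.sat_imp, sat_always_followsDir (hπ.suffix m),
      sat_prime_extTree hD h₁ h₂ (hπ.suffix m)]
    intro hv hfollow
    change extTree Φ l D (suffix π m 0) (.exist φ) = j.succ at hv
    simp only [extTree_dir] at hfollow
    -- The clause has content only for the number stored in `v_{E φ}`, and `hfollow` identifies the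
    -- path with the witness for which that number was chosen.
    by_cases hex : ∃ j, Sat l φ.1 (follow (fun x => D x j) (suffix π m 0))
    · simp only [extTree, dif_pos hex, Fin.succ_inj] at hv
      have := hex.choose_spec
      rw [hv, ← hfollow] at this
      exact this
    · simp only [extTree, dif_neg hex] at hv
      exact absurd hv.symm (Fin.succ_ne_zero j)
  · obtain ⟨h₁, h₂⟩ := (sub_of_mem_sub Φ).2 φ.1 φ.2
    rw [trace_suffix, LTL.sat_imp, sat_prime_extTree hD h₁ h₂ (hπ.suffix m)]
    intro hp
    exact of_decide_eq_true hp _ (hπ.suffix m) rfl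

end Completeness

end CTLStar

end CTLStarSynthesis

open CTLStarSynthesis in
theorem theorem1 {I : Type*} {O : Type*} [Fintype I] (Φ : CTLStar I O .state)
    {Q : {φ // φ ∈ Φ.existSub} → Type*} [∀ φ, Fintype (Q φ)]
    (A : ∀ φ : {φ // φ ∈ Φ.existSub}, NBW (Set Φ.AutProp) (Q φ))
    (hA : ∀ (φ : {φ // φ ∈ Φ.existSub}) (σ : ℕ → Set Φ.AutProp),
      (A φ).Accepts σ ↔ (Φ.autFormula φ.1).Sat σ)
    (k : ℕ) (hk : k = ∑ φ, Fintype.card (Q φ)) :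
    Φ.Realisable ↔ (Φ.toLTL k).Realisable := by
  constructor
  · rintro ⟨l, hl⟩
    subst hk
    obtain ⟨D, hD⟩ := CTLStar.exists_witness_directions A hA l
    exact CTLStar.toLTL_realisable hD hl
  · exact CTLStar.realisable_of_toLTL
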